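/- Let $q$ be a prime power, let $r\ge 1$ be an integer, and let $V$ be a vector space of dimension $2r+2$ over the finite field $\mathbb{F}_q$ equipped with a non-degenerate quadratic form $Q$ of Witt index $r$ (that is, the largest vector space dimension of a totally singular subspace of $V$, a subspace on which $Q$ vanishes identically, is $r$). The elliptic quadric $\mathcal{Q}^-(2r+1,q)$ is the set of points of the projective space $\mathrm{PG}(V)=\mathrm{PG}(2r+1,q)$ on which $Q$ vanishes; its generators are the maximal totally singular subspaces. For an integer $m\ge 0$, an $m$-ovoid is a set $\mathcal{O}$ of points of $\mathcal{Q}^-(2r+1,q)$ such that every generator contains exactly $m$ points of $\mathcal{O}$. If $\mathcal{Q}^-(2r+1,q)$ possesses an $m$-ovoid, then $$F(m)\equiv 0 \pmod{q+1},$$ where $$F(m)=\begin{cases} m^2-m & \text{if } r \text{ is odd},\\ m^2 & \text{if } r \text{ is even and } q \text{ is even},\\ m^2+\frac{q+1}{2}\,m & \text{if } r \text{ is even and } q \text{ is odd}.\end{cases}$$ -/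

import Mathlib

open scoped LinearAlgebra.Projectivization

namespace EllipticQuadric

section Forms

variable {K V : Type*} [Field K] [AddCommGroup V] [Module K V]

/-- A subspace is totally singular for `Q` if `Q` vanishes on all its vectors. -/
def TotallySingular (Q : QuadraticForm K V) (W : Submodule K V) : Prop :=
  ∀ x ∈ W, Q x = 0

/-- The Witt index of `Q` is `r`: the largest vector space dimension of a totally singular
subspace is `r`. -/
def HasWittIndex (Q : QuadraticForm K V) (r : ℕ) : Prop :=
  IsGreatest {k : ℕ | ∃ W : Submodule K V, TotallySingular Q W ∧ Module.finrank K W = k} r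

/-- `Q` defines an elliptic quadric of rank `r` in the projective space of the
`(2r+2)`-dimensional vector space `V`: it is non-degenerate and has Witt index `r`. -/
structure IsElliptic (Q : QuadraticForm K V) (r : ℕ) : Prop where
  finrank_eq : Module.finrank K V = 2 * r + 2
  nondegenerate : Q.Nondegenerate
  wittIndex : HasWittIndex Q r

/-- The points of the quadric: the projective points that are totally singular. -/
def points (Q : QuadraticForm K V) : Set (ℙ K V) :=
  {P | TotallySingular Q P.submodule}

/-- A generator: a totally singular subspace that is maximal with respect to inclusion. -/
def IsGenerator (Q : QuadraticForm K V) (W : Submodule K V) : Prop :=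
  Maximal (TotallySingular Q) W

/-- An `m`-ovoid: a set of points of the quadric of which every generator contains exactly
`m` (`Set.encard` is the cardinality in `ℕ∞`, so this includes finiteness). -/
structure IsOvoid (Q : QuadraticForm K V) (m : ℕ) (O : Set (ℙ K V)) : Prop where
  subset_points : O ⊆ points Q
  encard_inter : ∀ W : Submodule K V, IsGenerator Q W →
    {P : ℙ K V | P ∈ O ∧ P.submodule ≤ W}.encard = m

end Forms

/-- The polynomial expression in `m` of the modular condition; in the last case `q` is odd,
so that the integer division `(q + 1) / 2` is exact. -/
def F (r q : ℕ) (m : ℤ) : ℤ :=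
  if Odd r then m ^ 2 - m
  else if Even q then m ^ 2
  else m ^ 2 + ((q : ℤ) + 1) / 2 * m

end EllipticQuadric

namespace EllipticQuadric

open QuadraticMap

/-! The proof works with weighted ovoids: integer weights on points whose sum over each generator is
`m`. Projection from a singular point `x` of weight `a` gives a weighted `(m - a)`-ovoid of the
quadric of rank one less (`IsWeightedOvoid.project`). Its weights are sums along lines through `x`,
so they need not be 0 or 1; this is why weights are needed for induction on `r`.

Let `n` be the sum of the squared weights over the points. The central claim,
`IsWeightedOvoid.dvd_sum_sq`, is `n ≡ 2 * m ^ 2` modulo every `M` dividing both `2 * (q + 1)` and `q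
^ 2 - 1`. It is inherited from the projection through `sum_sq_perp`, obtained by counting weighted
pairs `(v, y)` with `v` orthogonal to both `x` and `y` in two ways. The counts need the weight of
the whole quadric, of `x`-perp and of `{x, y}`-perp: `sum_eq_total`, `sum_perp`, `sum_perp_perp`.

An actual ovoid has weights 0 and 1, so `n` is its size `m * (q ^ (r + 1) + 1)`. Taking `M = q + 1`
for `q` even and `M = 2 * (q + 1)` for `q` odd gives the theorem.

Sums run over vectors rather than points, which accounts for the factors `q - 1`. -/

open scoped Classical in
/-- The number of pairs `(a, b)` with `a * b = -c`. -/
theorem sum_mul_add_eq_zero {K : Type*} [Field K] [Fintype K] (c : K) :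
    ∑ a : K, ∑ b : K, (if a * b + c = 0 then (1 : ℤ) else 0) =
      (Fintype.card K - 1) + if c = 0 then (Fintype.card K : ℤ) else 0 := by
  have h (a : K) : ∑ b : K, (if a * b + c = 0 then (1 : ℤ) else 0) =
      1 + if a = 0 then (if c = 0 then (Fintype.card K : ℤ) else 0) - 1 else 0 := by
    by_cases ha : a = 0
    · subst ha
      split_ifs <;> simp_all
    · have (b : K) : a * b + c = 0 ↔ b = -c / a := by
        rw [eq_div_iff ha, mul_comm, eq_neg_iff_add_eq_zero]
      simp [this, ha]
  simp only [h, Finset.sum_add_distrib, Finset.sum_ite_eq', Finset.mem_univ, if_true]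
  simp
  ring

/-! ### Splitting off hyperbolic planes. -/

section

variable {K V V' : Type*} [Field K] [AddCommGroup V] [Module K V] [AddCommGroup V'] [Module K V']
  {Q : QuadraticForm K V} {Q' : QuadraticForm K V'}

/-- A nondegenerate form in `2 * r + 2` variables without totally singular subspaces of dimension
greater than `r`. -/
structure IsEllipticForm (Q : QuadraticForm K V) (r : ℕ) : Prop where
  finrank_eq : Module.finrank K V = 2 * r + 2
  eq_zero_of_polar : ∀ x, (∀ y, polar Q x y = 0) → x = 0
  finrank_le : ∀ W : Submodule K V, TotallySingular Q W → Module.finrank K W ≤ r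

/-- A linear equivalence that exhibits `Q` as the orthogonal sum of a hyperbolic plane and `Q'`. -/
def IsSplitting (Q : QuadraticForm K V) (Q' : QuadraticForm K V')
    (φ : (K × K × V') ≃ₗ[K] V) : Prop :=
  ∀ a b v, Q (φ (a, b, v)) = a * b + Q' v

theorem IsSplitting.polar_apply {φ : (K × K × V') ≃ₗ[K] V} (hφ : IsSplitting Q Q' φ)
    (a b : K) (v : V') (a' b' : K) (v' : V') :
    polar Q (φ (a, b, v)) (φ (a', b', v')) = a * b' + b * a' + polar Q' v v' := by
  simp only [polar, ← map_add, Prod.mk_add_mk, hφ _ _ _]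
  ring

theorem IsSplitting.polar_left {φ : (K × K × V') ≃ₗ[K] V} (hφ : IsSplitting Q Q' φ)
    (a b : K) (v : V') : polar Q (φ (1, 0, 0)) (φ (a, b, v)) = b := by
  simp [hφ.polar_apply]

theorem IsSplitting.polar_right {φ : (K × K × V') ≃ₗ[K] V} (hφ : IsSplitting Q Q' φ)
    (a b : K) (v : V') : polar Q (φ (0, 1, 0)) (φ (a, b, v)) = a := by
  simp [hφ.polar_apply]

theorem polar_eq_smul_add {Q : QuadraticForm K V} (x : V) (a : K) (y z : V) :
    polar Q x (a • y + z) = a * polar Q x y + polar Q x z := by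
  simp [polar_add_right, polar_smul_right]

/-- The coordinates of `v` along `x` and `y` are `polar Q y v` and `polar Q x v`, so the
decomposition needs neither nondegeneracy nor division by 2. -/
theorem exists_isSplitting {x y : V} (hx : Q x = 0) (hy : Q y = 0) (hxy : polar Q x y = 1) :
    ∃ (W : Submodule K V) (φ : (K × K × W) ≃ₗ[K] V),
      IsSplitting Q (Q.comp W.subtype) φ ∧ φ (1, 0, 0) = x ∧ φ (0, 1, 0) = y := by
  let W : Submodule K V := (Q.polarBilin x).ker ⊓ (Q.polarBilin y).ker
  have hyx : polar Q y x = 1 := by rw [polar_comm, hxy]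
  have hxx : polar Q x x = 0 := by rw [polar_self, hx]; simp
  have hyy : polar Q y y = 0 := by rw [polar_self, hy]; simp
  have hWx (w : W) : polar Q x w = 0 := w.2.1
  have hWy (w : W) : polar Q y w = 0 := w.2.2
  let f : (K × K × W) →ₗ[K] V :=
    (LinearMap.toSpanSingleton K V x).coprod ((LinearMap.toSpanSingleton K V y).coprod W.subtype)
  have hf (a b : K) (w : W) : f (a, b, w) = a • x + (b • y + w) := by simp [f]
  have hbij : Function.Bijective f := by
    constructor
    · rw [← LinearMap.ker_eq_bot, LinearMap.ker_eq_bot']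
      rintro ⟨a, b, w⟩ h
      rw [hf] at h
      have h1 := congrArg (polar Q x) h
      have h2 := congrArg (polar Q y) h
      simp only [polar_eq_smul_add, hxx, hyx, hxy, hyy, hWx, hWy, polar_zero_right] at h1 h2
      obtain rfl : b = 0 := by simpa using h1
      obtain rfl : a = 0 := by simpa using h2
      simpa using h
    · intro v
      have hv : v - polar Q y v • x - polar Q x v • y ∈ W := by
        constructor
        · simp [polar_sub_right, polar_smul_right, hxx, hxy]
        · simp [polar_sub_right, polar_smul_right, hyy, hyx]
      refine ⟨(polar Q y v, polar Q x v, ⟨_, hv⟩), ?_⟩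
      rw [hf]
      simp only
      abel
  refine ⟨W, LinearEquiv.ofBijective f hbij, fun a b w => ?_, ?_, ?_⟩
  · rw [LinearEquiv.ofBijective_apply, hf, QuadraticMap.map_add Q, QuadraticMap.map_add Q,
      polar_eq_smul_add, polar_smul_left, polar_smul_left, polar_smul_left,
      QuadraticMap.map_smul, QuadraticMap.map_smul, hx, hy, hxy, hWx, hWy]
    simp
    ring
  · simp [hf]
  · simp [hf]

theorem exists_hyperbolic_pair {x f : V} (hf : polar Q x f ≠ 0) (hx : Q x = 0) :
    ∃ a b : K, Q (a • f + b • x) = 0 ∧ polar Q x (a • f + b • x) = 1 := by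
  have hxx : polar Q x x = 0 := by rw [polar_self, hx]; simp
  -- Scaling `f` makes its pairing with `x` equal to 1; adding `b • x` then keeps the pairing and
  -- changes `Q` by `b`.
  refine ⟨(polar Q x f)⁻¹, -((polar Q x f)⁻¹ * (polar Q x f)⁻¹ * Q f), ?_, ?_⟩
  · rw [QuadraticMap.map_add Q, QuadraticMap.map_smul, QuadraticMap.map_smul, hx, polar_smul_left,
      polar_smul_right, polar_comm Q f x]
    simp only [smul_eq_mul]
    field_simp
    ring
  · simp [polar_add_right, polar_smul_right, hxx, hf]

theorem IsEllipticForm.exists_isSplitting {r : ℕ} (hQ : IsEllipticForm Q r) {x : V} (hx0 : x ≠ 0)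
    (hx : Q x = 0) : ∃ (W : Submodule K V) (φ : (K × K × W) ≃ₗ[K] V),
      IsSplitting Q (Q.comp W.subtype) φ ∧ φ (1, 0, 0) = x := by
  obtain ⟨f, hf⟩ : ∃ f, polar Q x f ≠ 0 := by
    by_contra! h
    exact hx0 (hQ.eq_zero_of_polar x h)
  obtain ⟨a, b, h1, h2⟩ := exists_hyperbolic_pair hf hx
  obtain ⟨W, φ, h, hφ, -⟩ := EllipticQuadric.exists_isSplitting hx h1 h2
  exact ⟨W, φ, h, hφ⟩

/-- `U` is the cone over `W` with vertex `φ (1, 0, 0)`. The explicit `ψ` serves to transport sums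
over `U`. -/
theorem IsSplitting.exists_totallySingular [FiniteDimensional K V'] {φ : (K × K × V') ≃ₗ[K] V}
    (hφ : IsSplitting Q Q' φ) {W : Submodule K V'} (hW : TotallySingular Q' W) :
    ∃ (U : Submodule K V) (ψ : (K × W) ≃ₗ[K] U), TotallySingular Q U ∧
      Module.finrank K U = Module.finrank K W + 1 ∧ ∀ a w, (ψ (a, w) : V) = φ (a, 0, w) := by
  let f : (K × W) →ₗ[K] V := φ.toLinearMap ∘ₗ
    (LinearMap.fst K K W).prod ((0 : (K × W) →ₗ[K] K).prod (W.subtype ∘ₗ LinearMap.snd K K W))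
  have hf (a : K) (w : W) : f (a, w) = φ (a, 0, w) := rfl
  have hinj : Function.Injective f := by
    rintro ⟨a, w⟩ ⟨a', w'⟩ h
    rw [hf, hf, φ.injective.eq_iff] at h
    simpa using h
  refine ⟨f.range, LinearEquiv.ofInjective f hinj, ?_, ?_, fun a w => hf a w⟩
  · rintro _ ⟨⟨a, w⟩, rfl⟩
    rw [hf, hφ]
    simp [hW w w.2]
  · rw [LinearMap.finrank_range_of_inj hinj, Module.finrank_prod, Module.finrank_self, add_comm]

theorem IsEllipticForm.finiteDimensional {r : ℕ} (hQ : IsEllipticForm Q r) :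
    FiniteDimensional K V :=
  FiniteDimensional.of_finrank_pos (by rw [hQ.finrank_eq]; omega)

theorem IsEllipticForm.of_isSplitting {r : ℕ} (hQ : IsEllipticForm Q (r + 1))
    {φ : (K × K × V') ≃ₗ[K] V} (hφ : IsSplitting Q Q' φ) : IsEllipticForm Q' r := by
  have := hQ.finiteDimensional
  have : FiniteDimensional K (K × K × V') := φ.symm.finiteDimensional
  have : FiniteDimensional K V' := FiniteDimensional.of_surjective
    (LinearMap.snd K K V' ∘ₗ LinearMap.snd K K (K × V')) (fun v => ⟨(0, 0, v), rfl⟩)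
  refine ⟨?_, fun v hv => ?_, fun W hW => ?_⟩
  · have h := φ.finrank_eq
    rw [Module.finrank_prod, Module.finrank_prod, Module.finrank_self, hQ.finrank_eq] at h
    omega
  · have : φ (0, 0, v) = 0 := hQ.eq_zero_of_polar _ fun y => by
      obtain ⟨⟨a, b, w⟩, rfl⟩ := φ.surjective y
      simp [hφ.polar_apply, hv]
    simpa using this
  · obtain ⟨U, -, hU, hU', -⟩ := hφ.exists_totallySingular hW
    have := hQ.finrank_le U hU
    omega

/-- Chevalley–Warning: degree 2 is less than the number of variables, so 0 is not the only zero. -/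
theorem exists_ne_zero_of_three_le_finrank [Finite K] (Q : QuadraticForm K V)
    (h : 3 ≤ Module.finrank K V) : ∃ x ≠ 0, Q x = 0 := by
  classical
  have : Fintype K := Fintype.ofFinite K
  have : FiniteDimensional K V := FiniteDimensional.of_finrank_pos (by omega)
  obtain ⟨B, rfl⟩ := LinearMap.BilinMap.toQuadraticMap_surjective Q
  let e := Module.finBasis K V
  let f : MvPolynomial (Fin (Module.finrank K V)) K :=
    ∑ i, ∑ j, MvPolynomial.C (B (e i) (e j)) * (MvPolynomial.X i * MvPolynomial.X j)
  have hf : f.totalDegree ≤ 2 := by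
    refine MvPolynomial.totalDegree_finsetSum_le fun i _ =>
      MvPolynomial.totalDegree_finsetSum_le fun j _ => ?_
    refine (MvPolynomial.totalDegree_mul _ _).trans ?_
    rw [MvPolynomial.totalDegree_C, zero_add]
    exact (MvPolynomial.totalDegree_mul _ _).trans (by simp)
  have heval (x : Fin (Module.finrank K V) → K) :
      MvPolynomial.eval x f = B (∑ i, x i • e i) (∑ i, x i • e i) := by
    simp only [f, map_sum, map_mul, MvPolynomial.eval_C, MvPolynomial.eval_X,
      LinearMap.sum_apply, map_smul, LinearMap.smul_apply, smul_eq_mul, Finset.mul_sum]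
    rw [Finset.sum_comm]
    refine Finset.sum_congr rfl fun i _ => Finset.sum_congr rfl fun j _ => by ring
  obtain ⟨p, hp⟩ := CharP.exists K
  have hprime : p.Prime := (CharP.char_is_prime_or_zero K p).resolve_right (CharP.char_ne_zero_of_finite K p)
  have hd := char_dvd_card_solutions p (f := f) (by rw [Fintype.card_fin]; omega)
  have hcard : 1 < Fintype.card {x : Fin (Module.finrank K V) → K // MvPolynomial.eval x f = 0} := by
    refine hprime.one_lt.trans_le (Nat.le_of_dvd ?_ hd)
    exact Fintype.card_pos_iff.2 ⟨⟨0, (heval 0).trans (by simp)⟩⟩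
  obtain ⟨x, hx⟩ := Fintype.exists_ne_of_one_lt_card hcard ⟨0, (heval 0).trans (by simp)⟩
  refine ⟨∑ i, x.1 i • e i, fun h0 => hx ?_, by simpa [heval] using x.2⟩
  ext i
  exact Fintype.linearIndependent_iff.1 e.linearIndependent _ h0 i

theorem IsEllipticForm.exists_isSplitting_succ [Finite K] {r : ℕ}
    (hQ : IsEllipticForm Q (r + 1)) : ∃ (W : Submodule K V) (φ : (K × K × W) ≃ₗ[K] V),
      IsSplitting Q (Q.comp W.subtype) φ := by
  obtain ⟨x, hx0, hx⟩ := exists_ne_zero_of_three_le_finrank Q (by rw [hQ.finrank_eq]; omega)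
  obtain ⟨W, φ, h, -⟩ := hQ.exists_isSplitting hx0 hx
  exact ⟨W, φ, h⟩

theorem IsEllipticForm.eq_zero_of_apply {Q : QuadraticForm K V} (hQ : IsEllipticForm Q 0) {v : V}
    (hv : Q v = 0) : v = 0 := by
  by_contra h
  have := hQ.finrank_le (K ∙ v) fun w hw => by
    obtain ⟨a, rfl⟩ := Submodule.mem_span_singleton.1 hw
    simp [QuadraticMap.map_smul, hv]
  rw [finrank_span_singleton h] at this
  omega

/-- The perp of `u` has dimension at least 3, so it contains a singular `e ≠ 0`, which is completed
to a hyperbolic pair inside that perp. -/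
theorem IsEllipticForm.exists_isSplitting_of_nonsingular [Finite K] {r : ℕ}
    (hQ : IsEllipticForm Q (r + 1)) {u : V} (hu : Q u ≠ 0) :
    ∃ (W : Submodule K V) (φ : (K × K × W) ≃ₗ[K] V) (w : W),
      IsSplitting Q (Q.comp W.subtype) φ ∧ φ (0, 0, w) = u := by
  have := hQ.finiteDimensional
  have hu0 : u ≠ 0 := by rintro rfl; simp at hu
  have hne : Q.polarBilin u ≠ 0 := fun h =>
    hu0 (hQ.eq_zero_of_polar u fun y => by simpa using LinearMap.congr_fun h y)
  have h1 := Module.Dual.finrank_ker_add_one_of_ne_zero hne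
  rw [hQ.finrank_eq] at h1
  obtain ⟨⟨e, he⟩, he0, hQe⟩ := exists_ne_zero_of_three_le_finrank
    (Q.comp (Q.polarBilin u).ker.subtype) (by omega)
  replace he : polar Q u e = 0 := he
  replace he0 : e ≠ 0 := fun h => he0 (by ext; exact h)
  replace hQe : Q e = 0 := hQe
  obtain ⟨f, hf, hef⟩ : ∃ f, polar Q u f = 0 ∧ polar Q e f ≠ 0 := by
    -- Otherwise `e` is orthogonal to all of the perp of `u`, hence a multiple of `u`, which is
    -- impossible for a nonzero singular vector.
    by_contra! h
    obtain ⟨w, hw⟩ : ∃ w, polar Q u w ≠ 0 := by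
      by_contra! h
      exact hu0 (hQ.eq_zero_of_polar u h)
    have hz : e - (polar Q e w / polar Q u w) • u = 0 := hQ.eq_zero_of_polar _ fun v => by
      have := h (v - (polar Q u v / polar Q u w) • w) (by
        simp [polar_sub_right, polar_smul_right, hw])
      simp only [polar_sub_right, polar_smul_right, smul_eq_mul] at this
      simp only [polar_sub_left, polar_smul_left, smul_eq_mul]
      linear_combination this
    have he' := sub_eq_zero.1 hz
    rw [he', QuadraticMap.map_smul, smul_eq_mul, mul_eq_zero, or_iff_left hu, mul_self_eq_zero] at hQe
    rw [hQe, zero_smul] at he'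
    exact he0 he'
  obtain ⟨a, b, h1, h2⟩ := exists_hyperbolic_pair hef hQe
  obtain ⟨W, φ, hφ, rfl, hφ'⟩ := EllipticQuadric.exists_isSplitting hQe h1 h2
  have hu' : polar Q (φ (0, 1, 0)) u = 0 := by
    rw [hφ', polar_comm, polar_add_right, polar_smul_right, polar_smul_right, hf, he]
    simp
  obtain ⟨⟨α, β, w⟩, rfl⟩ := φ.surjective u
  rw [polar_comm, hφ.polar_left] at he
  rw [hφ.polar_right] at hu'
  exact ⟨W, φ, w, hφ, by rw [he, hu']⟩

end

/-! ### Counting singular vectors. -/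

section

variable {K V V' : Type*} [Field K] [AddCommGroup V] [Module K V] [AddCommGroup V'] [Module K V']
  {Q : QuadraticForm K V} {Q' : QuadraticForm K V'} [Fintype K] [Fintype V] [Fintype V']

theorem sum_eq_sum_splitting {M : Type*} [AddCommMonoid M] (φ : (K × K × V') ≃ₗ[K] V) (F : V → M) :
    ∑ v, F v = ∑ a, ∑ b, ∑ v', F (φ (a, b, v')) := by
  rw [← φ.toEquiv.sum_comp, Fintype.sum_prod_type]
  refine Finset.sum_congr rfl fun a _ => ?_
  rw [Fintype.sum_prod_type]
  rfl

open scoped Classical in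
theorem IsEllipticForm.sum_polar_eq_zero {r : ℕ} (hQ : IsEllipticForm Q r) {u : V} (hu : u ≠ 0) :
    ∑ v, (if polar Q u v = 0 then (1 : ℤ) else 0) = (Fintype.card K : ℤ) ^ (2 * r + 1) := by
  have := hQ.finiteDimensional
  have hne : Q.polarBilin u ≠ 0 := fun h =>
    hu (hQ.eq_zero_of_polar u fun y => by simpa using LinearMap.congr_fun h y)
  have h1 := Module.Dual.finrank_ker_add_one_of_ne_zero hne
  rw [hQ.finrank_eq] at h1
  have h2 := Module.card_eq_pow_finrank (K := K) (V := (Q.polarBilin u).ker)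
  rw [show Module.finrank K (Q.polarBilin u).ker = 2 * r + 1 by omega] at h2
  rw [Finset.sum_boole, ← Nat.cast_pow, ← h2, Fintype.card_subtype]
  simp

open scoped Classical in
/-- The number of singular vectors in the perp of `u'` in `V'`, lifted to `V`. -/
theorem IsSplitting.sum_singular_perp {φ : (K × K × V') ≃ₗ[K] V} (hφ : IsSplitting Q Q' φ)
    (u : V') : ∑ v, (if Q v = 0 ∧ polar Q (φ (0, 0, u)) v = 0 then (1 : ℤ) else 0) =
      (Fintype.card K - 1) * ∑ v, (if polar Q' u v = 0 then (1 : ℤ) else 0) +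
      Fintype.card K * ∑ v, (if Q' v = 0 ∧ polar Q' u v = 0 then (1 : ℤ) else 0) := by
  have h (v : V') : ∑ a, ∑ b, (if Q (φ (a, b, v)) = 0 ∧ polar Q (φ (0, 0, u)) (φ (a, b, v)) = 0
        then (1 : ℤ) else 0) =
      (Fintype.card K - 1) * (if polar Q' u v = 0 then (1 : ℤ) else 0) +
      Fintype.card K * (if Q' v = 0 ∧ polar Q' u v = 0 then (1 : ℤ) else 0) := by
    simp only [hφ _ _ _, hφ.polar_apply, zero_mul, zero_add]
    by_cases hv : polar Q' u v = 0
    · simp only [hv, and_true, if_true, sum_mul_add_eq_zero]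
      split_ifs <;> simp
    · simp [hv]
  rw [sum_eq_sum_splitting φ, Finset.mul_sum, Finset.mul_sum, ← Finset.sum_add_distrib,
    ← Finset.sum_congr rfl fun v _ => h v, Finset.sum_comm_cycle]

open scoped Classical in
theorem IsEllipticForm.sum_singular {r : ℕ} (hQ : IsEllipticForm Q r) :
    ∑ v, (if Q v = 0 then (1 : ℤ) else 0) =
      (Fintype.card K : ℤ) ^ (2 * r + 1) - (Fintype.card K : ℤ) ^ (r + 1) +
      (Fintype.card K : ℤ) ^ r := by
  induction r generalizing V with
  | zero =>
    have h (v : V) : Q v = 0 ↔ v = 0 := ⟨hQ.eq_zero_of_apply, fun h => by simp [h]⟩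
    simp [h]
  | succ r ih =>
    obtain ⟨W, φ, hφ⟩ := hQ.exists_isSplitting_succ
    have hW := hQ.of_isSplitting hφ
    have := ih hW
    have key := hφ.sum_singular_perp 0
    have hc : (Fintype.card W : ℤ) = Fintype.card K ^ (2 * r + 2) := by
      have := hW.finiteDimensional
      rw [Module.card_eq_pow_finrank (K := K) (V := W), hW.finrank_eq]
      simp
    have h0 : φ (0, 0, 0) = 0 := map_zero φ
    simp only [h0, polar_zero_left, and_true, if_true, this, Finset.sum_const, Finset.card_univ,
      nsmul_eq_mul, mul_one, hc] at key
    rw [key]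
    ring

open scoped Classical in
-- In the perp of `φ (1, 0, 0)` the coordinate `b` is 0 and `a` is free, so the count is `q` times
-- that of `W`.
theorem IsEllipticForm.sum_singular_perp_of_singular {r : ℕ} (hQ : IsEllipticForm Q (r + 1)) {u : V}
    (hu : u ≠ 0) (hQu : Q u = 0) :
    ∑ v, (if Q v = 0 ∧ polar Q u v = 0 then (1 : ℤ) else 0) =
      (Fintype.card K : ℤ) ^ (2 * r + 2) - (Fintype.card K : ℤ) ^ (r + 2) +
      (Fintype.card K : ℤ) ^ (r + 1) := by
  obtain ⟨W, φ, hφ, rfl⟩ := hQ.exists_isSplitting hu hQu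
  have h := (hQ.of_isSplitting hφ).sum_singular
  rw [sum_eq_sum_splitting φ]
  simp only [hφ.polar_left, hφ _ _ _]
  have h1 (a : K) : ∑ b : K, ∑ v : W,
      (if a * b + (Q.comp W.subtype) v = 0 ∧ b = 0 then (1 : ℤ) else 0) =
      (Fintype.card K : ℤ) ^ (2 * r + 1) - (Fintype.card K : ℤ) ^ (r + 1) +
      (Fintype.card K : ℤ) ^ r := by
    rw [Finset.sum_eq_single 0 (fun b _ hb => by simp [hb]) (by simp), ← h]
    simp only [mul_zero, zero_add, and_true]
  simp only [h1, Finset.sum_const, Finset.card_univ, nsmul_eq_mul]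
  ring

open scoped Classical in
theorem IsEllipticForm.sum_singular_perp_of_nonsingular {r : ℕ} (hQ : IsEllipticForm Q r) {u : V}
    (hu : Q u ≠ 0) : ∑ v, (if Q v = 0 ∧ polar Q u v = 0 then (1 : ℤ) else 0) =
      (Fintype.card K : ℤ) ^ (2 * r) := by
  induction r generalizing V with
  | zero =>
    have h (v : V) : (Q v = 0 ∧ polar Q u v = 0) ↔ v = 0 :=
      ⟨fun h => hQ.eq_zero_of_apply h.1, fun h => by simp [h]⟩
    simp [h]
  | succ r ih =>
    obtain ⟨W, φ, w, hφ, rfl⟩ := hQ.exists_isSplitting_of_nonsingular hu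
    have hW := hQ.of_isSplitting hφ
    have hw : (Q.comp W.subtype) w ≠ 0 := by simpa [hφ _ _ _] using hu
    have hw0 : w ≠ 0 := by rintro rfl; simp at hw
    rw [hφ.sum_singular_perp, ih hW hw, hW.sum_polar_eq_zero hw0]
    ring

open scoped Classical in
-- The three cases merge into one formula that can be summed against weights; at `u = 0` both
-- corrections apply.
theorem IsEllipticForm.sum_singular_perp {r : ℕ} (hQ : IsEllipticForm Q r) (u : V) :
    ∑ v, (if Q v = 0 ∧ polar Q u v = 0 then (1 : ℤ) else 0) =
      (Fintype.card K : ℤ) ^ (2 * r)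
      - (if Q u = 0 then (Fintype.card K : ℤ) ^ (r + 1) - (Fintype.card K : ℤ) ^ r else 0)
      + (if u = 0 then (Fintype.card K : ℤ) ^ (2 * r + 1) - (Fintype.card K : ℤ) ^ (2 * r) else 0) := by
  by_cases hu : u = 0
  · subst hu
    simp [hQ.sum_singular]
    ring
  by_cases hQu : Q u = 0
  · obtain _ | r := r
    · exact absurd (hQ.eq_zero_of_apply hQu) hu
    · rw [hQ.sum_singular_perp_of_singular hu hQu]
      simp [hu, hQu]
      ring
  · simp [hQ.sum_singular_perp_of_nonsingular hQu, hu, hQu]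

end

/-! ### Weighted ovoids, their projections and their linear sums. -/

section

variable {K V V' : Type*} [Field K] [AddCommGroup V] [Module K V] [AddCommGroup V'] [Module K V']
  {Q : QuadraticForm K V} {Q' : QuadraticForm K V'}

/-- A function on vectors that comes from a function on projective points. -/
structure IsHomogeneous (K : Type*) {V : Type*} [Field K] [AddCommGroup V] [Module K V]
    (g : V → ℤ) : Prop where
  map_zero : g 0 = 0
  map_smul : ∀ (c : K) (v : V), c ≠ 0 → g (c • v) = g v

theorem IsHomogeneous.sum_eq [Fintype K] [Fintype V] [Fintype (ℙ K V)] {g : V → ℤ}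
    (hg : IsHomogeneous K g) :
    ∑ v, g v = (Fintype.card K - 1) * ∑ P : ℙ K V, g P.rep := by
  classical
  let f : ℙ K V × Kˣ → {v : V // v ≠ 0} := fun p =>
    ⟨(p.2 : K) • p.1.rep, smul_ne_zero p.2.ne_zero p.1.rep_nonzero⟩
  have hmk (p : ℙ K V × Kˣ) : Projectivization.mk K (f p).1 (f p).2 = p.1 := by
    conv_rhs => rw [← p.1.mk_rep]
    exact (Projectivization.mk_eq_mk_iff K _ _ _ _).2 ⟨p.2, rfl⟩
  have hf : Function.Bijective f := by
    constructor
    · intro p p' h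
      have h1 : p.1 = p'.1 := by
        rw [← hmk p, ← hmk p']
        congr 1
        exact congrArg Subtype.val h
      refine Prod.ext h1 (Units.ext (smul_left_injective K p.1.rep_nonzero ?_))
      have h2 : (p.2 : K) • p.1.rep = (p'.2 : K) • p'.1.rep := congrArg Subtype.val h
      rwa [← h1] at h2
    · intro v
      obtain ⟨c, hc⟩ := Projectivization.exists_smul_eq_mk_rep K v.1 v.2
      refine ⟨(Projectivization.mk K v.1 v.2, c⁻¹), Subtype.ext ?_⟩
      change ((c⁻¹ : Kˣ) : K) • (Projectivization.mk K v.1 v.2).rep = v.1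
      rw [← hc, ← Units.smul_def, inv_smul_smul]
  rw [← Finset.add_sum_erase _ _ (Finset.mem_univ 0), hg.map_zero, zero_add,
    Finset.sum_subtype (p := (· ≠ 0)) _ (by simp), ← hf.sum_comp, Fintype.sum_prod_type,
    Finset.mul_sum]
  refine Finset.sum_congr rfl fun P _ => ?_
  simp only [f, hg.map_smul _ _ (Units.ne_zero _), Finset.sum_const, Finset.card_univ,
    Fintype.card_units, nsmul_eq_mul, Nat.cast_sub Fintype.card_pos, Nat.cast_one]

theorem IsHomogeneous.ite_polar {g : V → ℤ} (hg : IsHomogeneous K g) (x : V)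
    [DecidablePred fun v => polar Q x v = 0] :
    IsHomogeneous K (fun v => if polar Q x v = 0 then g v else 0) := by
  refine ⟨by simp [hg.map_zero], fun c v hc => ?_⟩
  simp [polar_smul_right, hc, hg.map_smul c v hc]

/-- A weighted `m`-ovoid of the quadric of `Q`, written as a function on vectors. -/
structure IsWeightedOvoid [Fintype K] (Q : QuadraticForm K V) (r : ℕ) (m : ℤ) (g : V → ℤ) :
    Prop extends IsHomogeneous K g where
  eq_zero : ∀ v, Q v ≠ 0 → g v = 0
  sum_eq_mul : ∀ (W : Submodule K V) [Fintype W], TotallySingular Q W → Module.finrank K W = r →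
    ∑ w : W, g w = (Fintype.card K - 1) * m

open scoped Classical in
/-- The quotient of a weighted ovoid at the point `φ (1, 0, 0)`. -/
noncomputable def projectWeight [Fintype K] (φ : (K × K × V') ≃ₗ[K] V) (g : V → ℤ) (v : V') : ℤ :=
  -- The fibre over 0 is the span of the vertex itself; it is discarded so that the result is
  -- homogeneous.
  if v = 0 then 0 else ∑ a, g (φ (a, 0, v))

theorem IsHomogeneous.sum_line [Fintype K] {g : V → ℤ} (hg : IsHomogeneous K g)
    (v : V) : ∑ a : K, g (a • v) = (Fintype.card K - 1) * g v := by
  classical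
  rw [← Finset.add_sum_erase _ _ (Finset.mem_univ 0), zero_smul, hg.map_zero, zero_add,
    Finset.sum_congr rfl fun a ha => hg.map_smul a v (Finset.ne_of_mem_erase ha), Finset.sum_const,
    Finset.card_erase_of_mem (Finset.mem_univ _), Finset.card_univ, nsmul_eq_mul,
    Nat.cast_sub Fintype.card_pos]
  simp

theorem splitting_smul_left (φ : (K × K × V') ≃ₗ[K] V) (a : K) :
    φ (a, 0, 0) = a • φ (1, 0, 0) := by
  rw [← map_smul]; simp

theorem splitting_smul_right (φ : (K × K × V') ≃ₗ[K] V) (a : K) :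
    φ (0, a, 0) = a • φ (0, 1, 0) := by
  rw [← map_smul]; simp

/-- Summing over the fibres of the projection from the point `φ (1, 0, 0)`. -/
theorem IsHomogeneous.sum_project [Fintype K] {g : V → ℤ} (hg : IsHomogeneous K g)
    (φ : (K × K × V') ≃ₗ[K] V) (v : V') [Decidable (v = 0)] :
    ∑ a, g (φ (a, 0, v)) = projectWeight φ g v +
      if v = 0 then (Fintype.card K - 1) * g (φ (1, 0, 0)) else 0 := by
  by_cases hv : v = 0
  · subst hv
    rw [Finset.sum_congr rfl fun a _ => congrArg g (splitting_smul_left φ a), hg.sum_line]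
    simp [projectWeight]
  · simp [projectWeight, hv]

/-- The cone over a generator of `V'` is a generator of `V`; the vertex accounts for the loss of `g
(φ (1, 0, 0))`. -/
theorem IsWeightedOvoid.project [Fintype K] [Finite V'] {r : ℕ} {m : ℤ} {g : V → ℤ}
    (hg : IsWeightedOvoid Q (r + 1) m g) {φ : (K × K × V') ≃ₗ[K] V} (hφ : IsSplitting Q Q' φ) :
    IsWeightedOvoid Q' r (m - g (φ (1, 0, 0))) (projectWeight φ g) := by
  classical
  refine ⟨⟨by simp [projectWeight], fun c v hc => ?_⟩, fun v hv => ?_, fun W _ hW hr => ?_⟩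
  · by_cases hv : v = 0
    · simp [projectWeight, hv]
    · simp only [projectWeight, hv, smul_eq_zero, hc, or_self, if_false]
      refine (Fintype.sum_equiv (Equiv.mulLeft₀ c hc) _ _ fun a => ?_).symm
      rw [← hg.map_smul c _ hc, ← map_smul]
      simp
  · have hv0 : v ≠ 0 := by rintro rfl; simp at hv
    simp only [projectWeight, hv0, if_false]
    exact Finset.sum_eq_zero fun a _ => hg.eq_zero _ (by simpa [hφ _ _ _] using hv)
  · have : FiniteDimensional K V' := Module.Finite.of_finite
    obtain ⟨U, ψ, hU, hrank, hψ⟩ := hφ.exists_totallySingular hW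
    have : Fintype U := Fintype.ofEquiv _ ψ.toEquiv
    have h := hg.sum_eq_mul U hU (by omega)
    rw [← ψ.toEquiv.sum_comp, Fintype.sum_prod_type_right] at h
    have h2 (w : W) : ∑ a : K, g (ψ.toEquiv (a, w)) = projectWeight φ g w +
        if w = 0 then (Fintype.card K - 1) * g (φ (1, 0, 0)) else 0 := by
      have := hg.sum_project φ (w : V')
      simp only [ZeroMemClass.coe_eq_zero] at this
      rw [← this]
      exact Finset.sum_congr rfl fun a _ => congrArg g (hψ a w)
    simp only [h2, Finset.sum_add_distrib, Finset.sum_ite_eq', Finset.mem_univ, if_true] at h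
    linear_combination h

variable [Fintype K] [Fintype V] [Fintype V']

theorem one_lt_card_int (K : Type*) [Field K] [Fintype K] : (1 : ℤ) < Fintype.card K := by
  exact_mod_cast Fintype.one_lt_card

open scoped Classical in
theorem IsWeightedOvoid.sum_perp_of_project {r : ℕ} {m : ℤ} {g : V → ℤ} {φ : (K × K × V') ≃ₗ[K] V}
    (hg : IsWeightedOvoid Q (r + 1) m g) (hφ : IsSplitting Q Q' φ) :
    ∑ v, (if polar Q (φ (1, 0, 0)) v = 0 then g v else 0) =
      ∑ v, projectWeight φ g v + (Fintype.card K - 1) * g (φ (1, 0, 0)) := by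
  rw [sum_eq_sum_splitting φ]
  simp only [hφ.polar_left]
  have (a : K) : ∑ b, ∑ v, (if b = 0 then g (φ (a, b, v)) else 0) = ∑ v, g (φ (a, 0, v)) := by
    rw [Finset.sum_eq_single 0 (fun b _ hb => by simp [hb]) (by simp)]
    simp
  simp only [this]
  rw [Finset.sum_comm]
  simp only [hg.sum_project φ, Finset.sum_add_distrib, Finset.sum_ite_eq', Finset.mem_univ, if_true]

open scoped Classical in
/-- If the perp sums of a weighted ovoid are known then so is its total sum. -/
theorem IsWeightedOvoid.sum_of_sum_perp {r : ℕ} {m : ℤ} {g : V → ℤ}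
    (hQ : IsEllipticForm Q (r + 1)) (hg : IsWeightedOvoid Q (r + 1) m g)
    (h : ∀ x, x ≠ 0 → Q x = 0 → ∑ v, (if polar Q x v = 0 then g v else 0) =
      (Fintype.card K - 1) * (m * ((Fintype.card K : ℤ) ^ (r + 1) + 1)
        - (Fintype.card K : ℤ) ^ (r + 1) * g x)) :
    ∑ v, g v = (Fintype.card K - 1) * (m * ((Fintype.card K : ℤ) ^ (r + 2) + 1)) := by
  set q : ℤ := (Fintype.card K : ℤ) with hq
  have hq1 : 1 < q := one_lt_card_int K
  -- Pairs of a singular `x` and a `v` in its perp are counted in two ways. The vector `x = 0`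
  -- contributes the unknown total, hence the correction term.
  have h1 (x : V) : (if Q x = 0 then ∑ v, (if polar Q x v = 0 then g v else 0) else 0) =
      (if Q x = 0 then (q - 1) * (m * (q ^ (r + 1) + 1)) else 0) - (q - 1) * q ^ (r + 1) * g x +
      if x = 0 then ∑ v, g v - (q - 1) * (m * (q ^ (r + 1) + 1)) else 0 := by
    by_cases hx0 : x = 0
    · subst hx0
      simp [hg.map_zero]
    · by_cases hx : Q x = 0
      · simp only [hx, if_true, h x hx0 hx, hx0, if_false]
        ring
      · simp [hx, hx0, hg.eq_zero x hx]
  have h2 : ∑ x, (if Q x = 0 then ∑ v, (if polar Q x v = 0 then g v else 0) else 0) =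
      ∑ v, g v * ((q ^ (r + 1) * q ^ (r + 1)) - (q ^ (r + 2) - q ^ (r + 1))) := by
    have (x : V) : (if Q x = 0 then ∑ v, (if polar Q x v = 0 then g v else 0) else 0) =
        ∑ v, g v * (if Q x = 0 ∧ polar Q v x = 0 then 1 else 0) := by
      by_cases hx : Q x = 0
      · simp [hx, polar_comm Q x]
      · simp [hx]
    simp only [this]
    rw [Finset.sum_comm]
    refine Finset.sum_congr rfl fun v _ => ?_
    rw [← Finset.mul_sum, hQ.sum_singular_perp v]
    by_cases hv0 : v = 0
    · simp [hv0, hg.map_zero]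
    · by_cases hv : Q v = 0
      · simp only [hv, hv0, if_true, if_false, ← hq]
        ring
      · simp [hg.eq_zero v hv]
  have h3 := hQ.sum_singular
  rw [← hq] at h3
  have h4 : ∑ x, (if Q x = 0 then (q - 1) * (m * (q ^ (r + 1) + 1)) else 0) =
      (q - 1) * (m * (q ^ (r + 1) + 1)) * (q ^ (2 * (r + 1) + 1) - q ^ (r + 1 + 1) + q ^ (r + 1)) := by
    rw [← h3, Finset.mul_sum]
    simp
  simp only [h1, Finset.sum_add_distrib, Finset.sum_sub_distrib, Finset.sum_ite_eq', ← Finset.mul_sum,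
    Finset.mem_univ, if_true, h4, ← Finset.sum_mul] at h2
  have hp : 1 < q ^ (r + 1) := one_lt_pow₀ hq1 (by omega)
  have hne : (q ^ (r + 1) + 1) * (q ^ (r + 1) - 1) ≠ 0 :=
    mul_ne_zero (by linarith) (by linarith)
  apply mul_left_cancel₀ hne
  linear_combination -h2

/-- Induction on `r`: the total of the projection gives the perp sums, and these determine the
total. -/
theorem IsWeightedOvoid.sum_eq_total {r : ℕ} {m : ℤ} {g : V → ℤ} (hQ : IsEllipticForm Q r)
    (hg : IsWeightedOvoid Q r m g) :
    ∑ v, g v = (Fintype.card K - 1) * (m * ((Fintype.card K : ℤ) ^ (r + 1) + 1)) := by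
  classical
  induction r generalizing V m with
  | zero =>
    -- In rank 0 the only generator is the zero subspace, which forces `m = 0`.
    have hm := hg.sum_eq_mul ⊥ (by intro x hx; simp [(Submodule.mem_bot K).1 hx]) (by simp)
    have h0 : ∑ w : (⊥ : Submodule K V), g w = 0 :=
      Finset.sum_eq_zero fun w _ => by rw [(Submodule.mem_bot K).1 w.2, hg.map_zero]
    have h1 : ∑ v, g v = 0 := Finset.sum_eq_zero fun v _ => by
      by_cases hv : Q v = 0
      · rw [hQ.eq_zero_of_apply hv, hg.map_zero]
      · exact hg.eq_zero v hv
    rw [h1]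
    rw [h0] at hm
    linear_combination ((Fintype.card K : ℤ) ^ (0 + 1) + 1) * hm
  | succ r ih =>
    refine hg.sum_of_sum_perp hQ fun x hx0 hx => ?_
    obtain ⟨W, φ, hφ, rfl⟩ := hQ.exists_isSplitting hx0 hx
    rw [hg.sum_perp_of_project hφ, ih (hQ.of_isSplitting hφ) (hg.project hφ)]
    ring

open scoped Classical in
theorem IsWeightedOvoid.sum_perp {r : ℕ} {m : ℤ} {g : V → ℤ} (hQ : IsEllipticForm Q r)
    (hg : IsWeightedOvoid Q r m g) {x : V} (hx0 : x ≠ 0) (hx : Q x = 0) :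
    ∑ v, (if polar Q x v = 0 then g v else 0) =
      (Fintype.card K - 1) * (m * ((Fintype.card K : ℤ) ^ r + 1)
        - (Fintype.card K : ℤ) ^ r * g x) := by
  obtain _ | r := r
  · exact absurd (hQ.eq_zero_of_apply hx) hx0
  obtain ⟨W, φ, hφ, rfl⟩ := hQ.exists_isSplitting hx0 hx
  rw [hg.sum_perp_of_project hφ, (hg.project hφ).sum_eq_total (hQ.of_isSplitting hφ)]
  ring

end

/-! ### Perps of two points and the quadratic identity. -/

section

variable {K V V' : Type*} [Field K] [AddCommGroup V] [Module K V] [AddCommGroup V'] [Module K V']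
  {Q : QuadraticForm K V} {Q' : QuadraticForm K V'} [Fintype K] [Fintype V] [Fintype V']
  {r : ℕ} {m : ℤ} {g : V → ℤ}

open scoped Classical in
-- Exchanging the sums leaves, for each `u = φ (a, b, v)`, the number of singular `z` in the perp of
-- `v`, known from `IsEllipticForm.sum_singular_perp`.
theorem IsWeightedOvoid.sum_splitting_singular {φ : (K × K × V') ≃ₗ[K] V}
    (hQ : IsEllipticForm Q (r + 1)) (hg : IsWeightedOvoid Q (r + 1) m g)
    (hφ : IsSplitting Q Q' φ) :
    ∑ z, (if Q' z = 0 then ∑ u, (if polar Q (φ (0, 0, z)) u = 0 then g u else 0) else 0) =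
      (Fintype.card K : ℤ) ^ (2 * r) * ∑ v, g v
      - ((Fintype.card K : ℤ) ^ (r + 1) - (Fintype.card K : ℤ) ^ r) *
        (∑ v, (if polar Q (φ (1, 0, 0)) v = 0 then g v else 0) +
          ∑ v, (if polar Q (φ (0, 1, 0)) v = 0 then g v else 0) - ∑ v, g (φ (0, 0, v)))
      + ((Fintype.card K : ℤ) ^ (2 * r + 1) - (Fintype.card K : ℤ) ^ (2 * r)) *
        ((Fintype.card K - 1) * (g (φ (1, 0, 0)) + g (φ (0, 1, 0)))) := by
  have hD := (hQ.of_isSplitting hφ).sum_singular_perp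
  set q : ℤ := (Fintype.card K : ℤ) with hq
  have h1 (z : V') : (if Q' z = 0 then ∑ u, (if polar Q (φ (0, 0, z)) u = 0 then g u else 0) else 0) =
      ∑ a, ∑ b, ∑ v, g (φ (a, b, v)) * (if Q' z = 0 ∧ polar Q' v z = 0 then 1 else 0) := by
    rw [sum_eq_sum_splitting φ]
    by_cases hz : Q' z = 0
    · simp [hz, hφ.polar_apply, polar_comm Q' z]
    · simp [hz]
  have h2 : ∑ z, (if Q' z = 0 then ∑ u, (if polar Q (φ (0, 0, z)) u = 0 then g u else 0) else 0) =
      ∑ a, ∑ b, ∑ v, g (φ (a, b, v)) * (q ^ (2 * r)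
      - (if Q' v = 0 then q ^ (r + 1) - q ^ r else 0)
      + (if v = 0 then q ^ (2 * r + 1) - q ^ (2 * r) else 0)) := by
    simp only [h1, ← hD, Finset.mul_sum]
    rw [Finset.sum_comm]
    refine Finset.sum_congr rfl fun a _ => ?_
    rw [Finset.sum_comm]
    refine Finset.sum_congr rfl fun b _ => ?_
    rw [Finset.sum_comm]
  -- On the support of `g`, `a * b + Q' v = 0`, so `Q' v = 0` means `a = 0` or `b = 0`:
  -- inclusion–exclusion over the two perps.
  have h3 (a b : K) (v : V') : g (φ (a, b, v)) * (q ^ (2 * r)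
      - (if Q' v = 0 then q ^ (r + 1) - q ^ r else 0)
      + (if v = 0 then q ^ (2 * r + 1) - q ^ (2 * r) else 0)) =
      q ^ (2 * r) * g (φ (a, b, v)) - (q ^ (r + 1) - q ^ r) *
      ((if b = 0 then g (φ (a, b, v)) else 0) + (if a = 0 then g (φ (a, b, v)) else 0)
        - if a = 0 then if b = 0 then g (φ (a, b, v)) else 0 else 0)
      + (q ^ (2 * r + 1) - q ^ (2 * r)) *
        ((if b = 0 then if v = 0 then g (φ (a, b, v)) else 0 else 0) +
          (if a = 0 then if v = 0 then g (φ (a, b, v)) else 0 else 0)) := by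
    by_cases hs : a * b + Q' v = 0
    · by_cases ha : a = 0 <;> by_cases hb : b = 0
      · have hv : Q' v = 0 := by simpa [ha] using hs
        subst ha hb
        by_cases hv0 : v = 0
        · subst hv0
          have : φ (0, 0, 0) = 0 := map_zero φ
          simp [this, hg.map_zero]
        · simp [hv, hv0]
          ring
      · have hv : Q' v = 0 := by simpa [ha] using hs
        simp only [ha, hb, hv, if_true, if_false]
        split_ifs <;> ring
      · have hv : Q' v = 0 := by simpa [hb] using hs
        simp only [ha, hb, hv, if_true, if_false]
        split_ifs <;> ring
      · have hv : Q' v ≠ 0 := fun h => by simp [h, ha, hb] at hs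
        have hv0 : v ≠ 0 := by rintro rfl; simp at hv
        simp only [ha, hb, hv, hv0, if_false]
        ring
    · rw [hg.eq_zero _ (by rwa [hφ])]
      simp
  have hx : ∑ v, (if polar Q (φ (1, 0, 0)) v = 0 then g v else 0) =
      ∑ a, ∑ b, ∑ v, (if b = 0 then g (φ (a, b, v)) else 0) := by
    rw [sum_eq_sum_splitting φ]
    simp only [hφ.polar_left]
  have hy : ∑ v, (if polar Q (φ (0, 1, 0)) v = 0 then g v else 0) =
      ∑ a, ∑ b, ∑ v, (if a = 0 then g (φ (a, b, v)) else 0) := by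
    rw [sum_eq_sum_splitting φ]
    simp only [hφ.polar_right]
  have hxy : ∑ v, g (φ (0, 0, v)) =
      ∑ a, ∑ b, ∑ v, (if a = 0 then if b = 0 then g (φ (a, b, v)) else 0 else 0) := by
    symm
    rw [Finset.sum_eq_single 0 (fun a _ ha => by simp [ha]) (by simp),
      Finset.sum_eq_single 0 (fun a _ ha => by simp [ha]) (by simp)]
    simp only [if_true]
  have hx0 : (q - 1) * g (φ (1, 0, 0)) =
      ∑ a, ∑ b, ∑ v, (if b = 0 then if v = 0 then g (φ (a, b, v)) else 0 else 0) := by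
    rw [hq, ← hg.sum_line]
    refine Finset.sum_congr rfl fun a _ => ?_
    rw [Finset.sum_eq_single 0 (fun a _ ha => by simp [ha]) (by simp)]
    simp only [if_true, Finset.sum_ite_eq', Finset.mem_univ, splitting_smul_left φ a]
  have hy0 : (q - 1) * g (φ (0, 1, 0)) =
      ∑ a, ∑ b, ∑ v, (if a = 0 then if v = 0 then g (φ (a, b, v)) else 0 else 0) := by
    rw [Finset.sum_eq_single 0 (fun a _ ha => by simp [ha]) (by simp), hq, ← hg.sum_line]
    refine Finset.sum_congr rfl fun a _ => ?_
    simp only [if_true, Finset.sum_ite_eq', Finset.mem_univ, splitting_smul_right φ a]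
  rw [h2, mul_add (q - 1), hx0, hy0, hx, hy, hxy, sum_eq_sum_splitting φ g]
  simp only [h3, Finset.sum_add_distrib, Finset.sum_sub_distrib, ← Finset.mul_sum]

/-- The sum of a weighted ovoid over the perp of a hyperbolic plane. -/
theorem IsWeightedOvoid.sum_splitting {φ : (K × K × V') ≃ₗ[K] V}
    (hQ : IsEllipticForm Q (r + 1)) (hg : IsWeightedOvoid Q (r + 1) m g)
    (hφ : IsSplitting Q Q' φ) :
    ∑ v, g (φ (0, 0, v)) = (Fintype.card K - 1) * (m * ((Fintype.card K : ℤ) ^ r + 1)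
      - (Fintype.card K : ℤ) ^ r * (g (φ (1, 0, 0)) + g (φ (0, 1, 0)))) := by
  classical
  have key := hg.sum_splitting_singular hQ hφ
  have hQx : Q (φ (1, 0, 0)) = 0 := by simp [hφ _ _ _]
  have hQy : Q (φ (0, 1, 0)) = 0 := by simp [hφ _ _ _]
  rw [hg.sum_perp hQ (by simp) hQx, hg.sum_perp hQ (by simp) hQy, hg.sum_eq_total hQ] at key
  have hZ := (hQ.of_isSplitting hφ).sum_singular
  set q : ℤ := (Fintype.card K : ℤ) with hq
  have hq1 : 1 < q := one_lt_card_int K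
  have h1 (z : V') : (if Q' z = 0 then ∑ u, (if polar Q (φ (0, 0, z)) u = 0 then g u else 0) else 0) =
      (q - 1) * (m * (q ^ (r + 1) + 1)) * (if Q' z = 0 then 1 else 0)
      - (q - 1) * q ^ (r + 1) * g (φ (0, 0, z)) +
      if z = 0 then (q - 1) * (m * (q ^ (r + 1 + 1) + 1)) - (q - 1) * (m * (q ^ (r + 1) + 1))
      else 0 := by
    by_cases hz0 : z = 0
    · subst hz0
      have : φ (0, 0, 0) = 0 := map_zero φ
      simp [this, hg.map_zero, hg.sum_eq_total hQ, ← hq]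
    · have hQz : Q (φ (0, 0, z)) = Q' z := by simp [hφ _ _ _]
      by_cases hz : Q' z = 0
      · simp only [hz, if_true, hz0, if_false]
        rw [hg.sum_perp hQ (by simpa using hz0) (hQz.trans hz), ← hq]
        ring
      · rw [hg.eq_zero _ (by rwa [hQz])]
        simp [hz, hz0]
  simp only [h1, Finset.sum_add_distrib, Finset.sum_sub_distrib, ← Finset.mul_sum, hZ,
    Finset.sum_ite_eq', Finset.mem_univ, if_true] at key
  -- This is the total coefficient of the unknown sum over both evaluations.
  have hne : q ^ r * (q - 1) * (q + 1) ≠ 0 := by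
    have : 0 < q ^ r := pow_pos (by linarith) _
    exact mul_ne_zero (mul_ne_zero this.ne' (by linarith)) (by linarith)
  apply mul_left_cancel₀ hne
  linear_combination -key

open scoped Classical in
theorem IsWeightedOvoid.sum_perp_perp (hQ : IsEllipticForm Q (r + 1))
    (hg : IsWeightedOvoid Q (r + 1) m g) {x y : V} (hx : Q x = 0) (hy : Q y = 0)
    (hxy : polar Q x y ≠ 0) :
    ∑ v, (if polar Q x v = 0 ∧ polar Q y v = 0 then g v else 0) =
      (Fintype.card K - 1) * (m * ((Fintype.card K : ℤ) ^ r + 1)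
      - (Fintype.card K : ℤ) ^ r * (g x + g y)) := by
  have hc : (polar Q x y)⁻¹ ≠ 0 := inv_ne_zero hxy
  obtain ⟨W, φ, hφ, rfl, hφy⟩ := exists_isSplitting (y := (polar Q x y)⁻¹ • y) hx
    (by simp [QuadraticMap.map_smul, hy]) (by simp [polar_smul_right, hxy])
  rw [← hg.map_smul _ y hc, ← hφy, ← hg.sum_splitting hQ hφ, sum_eq_sum_splitting φ]
  have (v : V) : polar Q y v = 0 ↔ polar Q (φ (0, 1, 0)) v = 0 := by
    rw [hφy, polar_smul_left]
    simp [hxy]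
  simp only [this, hφ.polar_left, hφ.polar_right]
  rw [Finset.sum_eq_single 0 (fun a _ ha => by simp [ha]) (by simp),
    Finset.sum_eq_single 0 (fun a _ ha => by simp [ha]) (by simp)]
  simp

open scoped Classical in
-- The perp of the line joining the two points projects onto the perp of `w`, so `sum_perp` applies
-- to the projected weight.
theorem IsWeightedOvoid.sum_perp_perp_of_collinear {φ : (K × K × V') ≃ₗ[K] V}
    (hQ : IsEllipticForm Q (r + 1)) (hg : IsWeightedOvoid Q (r + 1) m g)
    (hφ : IsSplitting Q Q' φ) (a : K) {w : V'} (hw0 : w ≠ 0) (hw : Q' w = 0) :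
    ∑ v, (if polar Q (φ (1, 0, 0)) v = 0 ∧ polar Q (φ (a, 0, w)) v = 0 then g v else 0) =
      (Fintype.card K - 1) * ((m - g (φ (1, 0, 0))) * ((Fintype.card K : ℤ) ^ r + 1)
      + g (φ (1, 0, 0)) - (Fintype.card K : ℤ) ^ r * projectWeight φ g w) := by
  have h := (hg.project hφ).sum_perp (hQ.of_isSplitting hφ) hw0 hw
  rw [sum_eq_sum_splitting φ]
  simp only [hφ.polar_left, hφ.polar_apply]
  have h1 (c : K) : ∑ b, ∑ v, (if b = 0 ∧ a * b + 0 * c + polar Q' w v = 0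
      then g (φ (c, b, v)) else 0) = ∑ v, if polar Q' w v = 0 then g (φ (c, 0, v)) else 0 := by
    rw [Finset.sum_eq_single 0 (fun b _ hb => by simp [hb]) (by simp)]
    simp
  simp only [h1]
  rw [Finset.sum_comm]
  have h2 (v : V') : ∑ c, (if polar Q' w v = 0 then g (φ (c, 0, v)) else 0) =
      (if polar Q' w v = 0 then projectWeight φ g v else 0) +
        if v = 0 then (Fintype.card K - 1) * g (φ (1, 0, 0)) else 0 := by
    by_cases hv : polar Q' w v = 0
    · simp only [hv, if_true, hg.sum_project]
    · have : v ≠ 0 := by rintro rfl; simp at hv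
      simp [hv, this]
  simp only [h2, Finset.sum_add_distrib, Finset.sum_ite_eq', Finset.mem_univ, if_true, h]
  ring

open scoped Classical in
/-- The contribution of the points collinear with `φ (1, 0, 0)` to the quadratic count. -/
theorem IsWeightedOvoid.sum_collinear {φ : (K × K × V') ≃ₗ[K] V}
    (hQ : IsEllipticForm Q (r + 1)) (hg : IsWeightedOvoid Q (r + 1) m g)
    (hφ : IsSplitting Q Q' φ) :
    ∑ y, (if polar Q (φ (1, 0, 0)) y = 0 then
      g y * ∑ v, (if polar Q (φ (1, 0, 0)) v = 0 ∧ polar Q y v = 0 then g v else 0) else 0) =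
    (Fintype.card K - 1) * g (φ (1, 0, 0)) *
      ∑ v, (if polar Q (φ (1, 0, 0)) v = 0 then g v else 0) +
    (Fintype.card K - 1) * ((m - g (φ (1, 0, 0))) * ((Fintype.card K : ℤ) ^ r + 1)
      + g (φ (1, 0, 0))) * ∑ w, projectWeight φ g w -
    (Fintype.card K - 1) * (Fintype.card K : ℤ) ^ r * ∑ w, projectWeight φ g w ^ 2 := by
  set q : ℤ := (Fintype.card K : ℤ) with hq
  set x := φ (1, 0, 0) with hx
  let R (y : V) : ℤ := ∑ v, (if polar Q x v = 0 ∧ polar Q y v = 0 then g v else 0)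
  have h1 : ∑ y, (if polar Q x y = 0 then g y * R y else 0) =
      ∑ w, ∑ a, g (φ (a, 0, w)) * R (φ (a, 0, w)) := by
    rw [sum_eq_sum_splitting φ]
    simp only [hx, hφ.polar_left]
    rw [Finset.sum_comm]
    rw [Finset.sum_eq_single 0 (fun b _ hb => by simp [hb]) (by simp)]
    simp only [if_true]
    rw [Finset.sum_comm]
  have h2 (w : V') : ∑ a, g (φ (a, 0, w)) * R (φ (a, 0, w)) =
      (if w = 0 then (q - 1) * g x * ∑ v, (if polar Q x v = 0 then g v else 0) else 0) +
      (q - 1) * ((m - g x) * (q ^ r + 1) + g x) * projectWeight φ g w -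
      (q - 1) * q ^ r * projectWeight φ g w ^ 2 := by
    by_cases hw0 : w = 0
    · subst hw0
      have (a : K) : g (φ (a, 0, 0)) * R (φ (a, 0, 0)) =
          g (a • x) * ∑ v, (if polar Q x v = 0 then g v else 0) := by
        rw [splitting_smul_left φ a, ← hx]
        by_cases ha : a = 0
        · simp [ha, hg.map_zero]
        · simp [R, polar_smul_left, ha]
      simp only [this, ← Finset.sum_mul, hg.sum_line]
      simp [projectWeight, ← hq]
    by_cases hw : Q' w = 0
    · have (a : K) := hg.sum_perp_perp_of_collinear hQ hφ a hw0 hw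
      rw [← hx, ← hq] at this
      simp only [R, this, ← Finset.sum_mul]
      simp only [projectWeight, hw0, if_false]
      ring
    · have h0 (a : K) : g (φ (a, 0, w)) = 0 := hg.eq_zero _ (by simpa [hφ _ _ _] using hw)
      simp [projectWeight, h0, hw0]
  change ∑ y, (if polar Q x y = 0 then g y * R y else 0) = _
  rw [h1]
  simp only [h2, Finset.sum_add_distrib, Finset.sum_sub_distrib, ← Finset.mul_sum,
    Finset.sum_ite_eq', Finset.mem_univ, if_true]

open scoped Classical in
/-- The quadratic identity between a weighted ovoid and its quotient at a point. -/
theorem IsWeightedOvoid.sum_sq_perp {φ : (K × K × V') ≃ₗ[K] V}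
    (hQ : IsEllipticForm Q (r + 1)) (hg : IsWeightedOvoid Q (r + 1) m g)
    (hφ : IsSplitting Q Q' φ) {q a : ℤ} (hq : q = Fintype.card K) (ha : a = g (φ (1, 0, 0))) :
    (q + 1) * ∑ v, (if polar Q (φ (1, 0, 0)) v = 0 then g v ^ 2 else 0) =
      ∑ v, g v ^ 2 + ∑ w, projectWeight φ g w ^ 2 + (q - 1) *
      ((a - m) * (m * (q ^ (r + 2) + 1)) + q * m * (m * (q ^ (r + 1) + 1) - q ^ (r + 1) * a)
        + q * m ^ 2 * (1 - q) + (q - 1) * a ^ 2 + (1 - 2 * q) * m * a) := by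
  have hcol := hg.sum_collinear hQ hφ
  have hQx : Q (φ (1, 0, 0)) = 0 := by simp [hφ _ _ _]
  have hT := hg.sum_perp hQ (x := φ (1, 0, 0)) (by simp) hQx
  have hW := hg.sum_eq_total hQ
  have hW' := (hg.project hφ).sum_eq_total (hQ.of_isSplitting hφ)
  have hS (y : V) := hg.sum_perp_perp hQ (y := y) hQx
  have hTy (y : V) := hg.sum_perp hQ (x := y)
  rw [← hq, ← ha] at hcol hT hW'
  rw [← hq] at hW
  rw [← hq, ← ha] at hS
  simp only [← hq] at hTy
  set x := φ (1, 0, 0) with hx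
  -- Double count of pairs `(v, y)`: `hleft` fixes `y` and separates `y` orthogonal to `x` from the
  -- rest; `hright` fixes `v`.
  have hleft (y : V) : g y * ∑ v, (if polar Q x v = 0 ∧ polar Q y v = 0 then g v else 0) =
      (if polar Q x y = 0 then
        g y * ∑ v, (if polar Q x v = 0 ∧ polar Q y v = 0 then g v else 0) else 0) +
      ((q - 1) * (m * (q ^ r + 1) - q ^ r * a) * (g y - if polar Q x y = 0 then g y else 0) -
      (q - 1) * q ^ r * (g y ^ 2 - if polar Q x y = 0 then g y ^ 2 else 0)) := by
    by_cases hxy : polar Q x y = 0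
    · simp [hxy]
    · by_cases hy : Q y = 0
      · rw [hS y hy hxy]
        simp only [hxy, if_false]
        ring
      · simp [hg.eq_zero y hy]
  have hright (v : V) : (if polar Q x v = 0 then g v * ∑ y, (if polar Q v y = 0 then g y else 0)
      else 0) = (q - 1) * (m * (q ^ (r + 1) + 1)) * (if polar Q x v = 0 then g v else 0)
      - (q - 1) * q ^ (r + 1) * (if polar Q x v = 0 then g v ^ 2 else 0) := by
    by_cases hxv : polar Q x v = 0
    · by_cases hv0 : v = 0
      · simp [hv0, hg.map_zero]
      by_cases hv : Q v = 0
      · rw [hTy v hv0 hv]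
        simp only [hxv, if_true]
        ring
      · simp [hg.eq_zero v hv]
    · simp [hxv]
  have hcount : ∑ y, g y * ∑ v, (if polar Q x v = 0 ∧ polar Q y v = 0 then g v else 0) =
      ∑ v, (if polar Q x v = 0 then g v * ∑ y, (if polar Q v y = 0 then g y else 0) else 0) := by
    simp only [Finset.mul_sum]
    rw [Finset.sum_comm]
    refine Finset.sum_congr rfl fun v _ => ?_
    by_cases hxv : polar Q x v = 0
    · simp only [hxv, true_and, if_true]
      refine Finset.sum_congr rfl fun y _ => ?_
      rw [polar_comm Q v y]
      split_ifs <;> ring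
    · simp [hxv]
  rw [Finset.sum_congr rfl fun y _ => hleft y, Finset.sum_congr rfl fun v _ => hright v] at hcount
  simp only [Finset.sum_add_distrib, Finset.sum_sub_distrib, ← Finset.mul_sum, hcol, hT, hW,
    hW'] at hcount
  have hq1 : 1 < q := hq ▸ one_lt_card_int K
  have hne : q ^ r * (q - 1) ≠ 0 := by
    have : 0 < q ^ r := pow_pos (by linarith) _
    exact mul_ne_zero this.ne' (by linarith)
  apply mul_left_cancel₀ hne
  linear_combination hcount

end

/-! ### The congruence for the sum of squares. -/

section

theorem pow_modEq_one_or_self {M q : ℤ} (h : M ∣ q ^ 2 - 1) (r : ℕ) :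
    (Even r → M ∣ q ^ r - 1) ∧ (Odd r → M ∣ q ^ r - q) := by
  have key (k : ℕ) : M ∣ q ^ (2 * k) - 1 := by
    rw [pow_mul]
    simpa using h.trans (sub_one_dvd_pow_sub_one (q ^ 2) k)
  constructor
  · rintro ⟨k, rfl⟩
    rw [← two_mul]
    exact key k
  · rintro ⟨k, rfl⟩
    have := (key k).mul_left q
    rwa [show q * (q ^ (2 * k) - 1) = q ^ (2 * k + 1) - q by ring] at this

theorem dvd_sub_of_quadratic_identity {M q p m a n n' k : ℤ} (h1 : M ∣ 2 * (q + 1))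
    (h2 : M ∣ q ^ 2 - 1) (hp : M ∣ p - 1 ∨ M ∣ p - q) (hn' : M ∣ n' - 2 * (m - a) ^ 2)
    (h : (q + 1) * (m * (q * p + 1) - q * p * a + 2 * k) = n + n' +
      ((a - m) * (m * (q ^ 2 * p + 1)) + q * m * (m * (q * p + 1) - q * p * a)
        + q * m ^ 2 * (1 - q) + (q - 1) * a ^ 2 + (1 - 2 * q) * m * a)) :
    M ∣ n - 2 * m ^ 2 := by
  -- Evenness matters: `M` divides `2 * (q + 1)` but perhaps not `q + 1`.
  obtain ⟨b, hb⟩ : ∃ b, a ^ 2 + a = 2 * b := by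
    obtain ⟨b, hb⟩ := Int.even_mul_succ_self a
    exact ⟨b, by linear_combination hb⟩
  obtain ⟨u, hu⟩ := h1
  obtain ⟨d, hd⟩ := h2
  obtain ⟨e, he⟩ := hn'
  rcases hp with ⟨s, hs⟩ | ⟨s, hs⟩
  · refine ⟨-e + u * k + d * (m - a + m ^ 2) + u * (m - m ^ 2 + m * a - b) + s * ((q + 1) * (m * q - q * a)
      - (a - m) * m * q ^ 2 - q * m * (m * q - q * a)), ?_⟩
    linear_combination -h - he + hu * (k + (m - m ^ 2 + m * a - b)) + hd * (m - a + m ^ 2) +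
      hs * ((q + 1) * (m * q - q * a) - (a - m) * m * q ^ 2 - q * m * (m * q - q * a)) - (q + 1) * hb
  · refine ⟨-e + u * k + d * ((q + 1) * (m - a) + m ^ 2) + u * (m - m ^ 2 + m * a - b) +
      s * ((q + 1) * (m * q - q * a) - (a - m) * m * q ^ 2 - q * m * (m * q - q * a)), ?_⟩
    linear_combination -h - he + hu * (k + (m - m ^ 2 + m * a - b)) +
      hd * ((q + 1) * (m - a) + m ^ 2) +
      hs * ((q + 1) * (m * q - q * a) - (a - m) * m * q ^ 2 - q * m * (m * q - q * a)) - (q + 1) * hb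

variable {K V : Type*} [Field K] [AddCommGroup V] [Module K V] {Q : QuadraticForm K V}

theorem IsHomogeneous.dvd_sum [Fintype K] [Fintype V] {g : V → ℤ} (hg : IsHomogeneous K g)
    {d : ℤ} (h : ∀ v, d ∣ g v) : ∃ k, ∑ v, g v = (Fintype.card K - 1) * (d * k) := by
  have := Fintype.ofFinite (ℙ K V)
  obtain ⟨k, hk⟩ : d ∣ ∑ P : ℙ K V, g P.rep := Finset.dvd_sum fun P _ => h _
  exact ⟨k, by rw [hg.sum_eq, hk]⟩

theorem IsHomogeneous.comp {g : V → ℤ} (hg : IsHomogeneous K g) {f : ℤ → ℤ} (hf : f 0 = 0) :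
    IsHomogeneous K (fun v => f (g v)) :=
  ⟨by rw [hg.map_zero, hf], fun c v hc => by rw [hg.map_smul c v hc]⟩

/-- The sum of the squares of the weights of a weighted `m`-ovoid is congruent to `2 * m ^ 2`. -/
theorem IsWeightedOvoid.dvd_sum_sq [Fintype K] [Fintype V] {M : ℤ}
    (h1 : M ∣ 2 * ((Fintype.card K : ℤ) + 1)) (h2 : M ∣ (Fintype.card K : ℤ) ^ 2 - 1) {r : ℕ}
    (hQ : IsEllipticForm Q r) {m : ℤ} {g : V → ℤ} (hg : IsWeightedOvoid Q r m g) {n : ℤ}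
    (hn : ∑ v, g v ^ 2 = (Fintype.card K - 1) * n) : M ∣ n - 2 * m ^ 2 := by
  classical
  have hq1 : (1 : ℤ) < Fintype.card K := one_lt_card_int K
  have hne : (Fintype.card K : ℤ) - 1 ≠ 0 := by linarith
  induction r generalizing V m n with
  | zero =>
    have h0 (v : V) : g v = 0 := by
      by_cases hv : Q v = 0
      · rw [hQ.eq_zero_of_apply hv, hg.map_zero]
      · exact hg.eq_zero v hv
    have hW := hg.sum_eq_total hQ
    simp only [h0, Finset.sum_const_zero, zero_pow two_ne_zero] at hn hW
    obtain rfl : n = 0 := by simpa [hne] using hn.symm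
    have hne' : (Fintype.card K : ℤ) ^ (0 + 1) + 1 ≠ 0 := by positivity
    obtain rfl : m = 0 := by simpa only [mul_eq_zero, hne, hne', false_or, or_false] using hW.symm
    simp
  | succ r ih =>
    obtain ⟨x, hx0, hx⟩ := exists_ne_zero_of_three_le_finrank Q (by rw [hQ.finrank_eq]; omega)
    obtain ⟨W, φ, hφ, rfl⟩ := hQ.exists_isSplitting hx0 hx
    have hg' := hg.project hφ
    obtain ⟨n', hn'⟩ := (hg'.comp (f := fun t => t ^ 2) (by simp)).dvd_sum (d := 1) (by simp)
    rw [one_mul] at hn'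
    have hdvd := ih (hQ.of_isSplitting hφ) hg' hn'
    have hid := hg.sum_sq_perp hQ hφ rfl rfl
    have hT := hg.sum_perp hQ hx0 hx
    -- As `t ^ 2 - t` is even, the squares over the perp sum to the known linear sum plus `2 * k`;
    -- multiplied by `q + 1`, the unknown `k` vanishes modulo `M`.
    obtain ⟨k, hk⟩ := ((hg.comp (f := fun t => t ^ 2 - t) (by simp)).ite_polar (Q := Q)
      (φ (1, 0, 0))).dvd_sum (d := 2) (fun v => by
        split_ifs
        · have := (Int.even_mul_pred_self (g v)).two_dvd
          rwa [show g v * (g v - 1) = g v ^ 2 - g v by ring] at this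
        · exact dvd_zero _)
    have hsq : ∑ v, (if polar Q (φ (1, 0, 0)) v = 0 then g v ^ 2 else 0) =
        ∑ v, (if polar Q (φ (1, 0, 0)) v = 0 then g v else 0) +
        ∑ v, (if polar Q (φ (1, 0, 0)) v = 0 then g v ^ 2 - g v else 0) := by
      rw [← Finset.sum_add_distrib]
      refine Finset.sum_congr rfl fun v _ => ?_
      split_ifs <;> ring
    rw [hsq, hT, hk, hn, hn'] at hid
    have hp : M ∣ (Fintype.card K : ℤ) ^ r - 1 ∨ M ∣ (Fintype.card K : ℤ) ^ r - Fintype.card K :=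
      (Nat.even_or_odd r).imp (pow_modEq_one_or_self h2 r).1 (pow_modEq_one_or_self h2 r).2
    refine dvd_sub_of_quadratic_identity h1 h2 hp hdvd (k := k) (mul_left_cancel₀ hne ?_)
    linear_combination hid

/-! ### From elliptic quadrics and ovoids to forms and weights. -/

theorem exists_add_smul_singular [Finite K] [CharP K 2] {e v : V} (he : ∀ y, polar Q e y = 0)
    (hQe : Q e ≠ 0) : ∃ t : K, Q (v + t • e) = 0 := by
  obtain ⟨t, ht⟩ := (FiniteField.isSquare_of_char_two (F := K) (ringChar.eq K 2)
    (Q v / Q e) : IsSquare _)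
  refine ⟨t, ?_⟩
  rw [QuadraticMap.map_add Q, QuadraticMap.map_smul, polar_smul_right, polar_comm, he, ← ht]
  simp only [smul_eq_mul, mul_zero, add_zero]
  rw [div_mul_cancel₀ _ hQe, CharTwo.add_self_eq_zero]

/-- An elliptic quadric has a nondegenerate polar form, in every characteristic. -/
theorem IsElliptic.isEllipticForm [Finite K] {r : ℕ} (hQ : IsElliptic Q r) :
    IsEllipticForm Q r := by
  have : FiniteDimensional K V := FiniteDimensional.of_finrank_pos (by rw [hQ.finrank_eq]; omega)
  have hle (W : Submodule K V) (hW : TotallySingular Q W) : Module.finrank K W ≤ r :=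
    hQ.wittIndex.2 ⟨W, hW, rfl⟩
  refine ⟨hQ.finrank_eq, fun e he => ?_, hle⟩
  have hpolar : Q.polarBilin e = 0 := LinearMap.ext he
  by_cases hQe : Q e = 0
  · have : e ∈ Q.radical := ⟨hQe, hpolar⟩
    rwa [hQ.nondegenerate.radical_eq_bot, Submodule.mem_bot] at this
  exfalso
  have h2 : (2 : K) = 0 := by
    have h := he e
    rw [polar_self, nsmul_eq_mul, Nat.cast_ofNat, mul_eq_zero, or_iff_left hQe] at h
    exact h
  have : CharP K 2 := CharTwo.of_one_ne_zero_of_two_eq_zero one_ne_zero h2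
  obtain ⟨U, hU, hUr⟩ := hQ.wittIndex.1
  -- The kernel of `f` is the perp of `U`, of dimension at least `r + 2`, so it leaves `U ⊔ K ∙ e`.
  -- Correcting such a vector by a multiple of `e` makes it singular and enlarges `U`.
  let f : V →ₗ[K] Module.Dual K U := U.dualRestrict ∘ₗ Q.polarBilin
  have hker := f.finrank_range_add_finrank_ker
  have hrange : Module.finrank K f.range ≤ r := by
    rw [← hUr, ← Subspace.dual_finrank_eq (K := K) (V := U)]
    exact Submodule.finrank_le _
  have hsup : Module.finrank K ↥(U ⊔ K ∙ e) ≤ r + 1 := by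
    refine (Submodule.finrank_add_le_finrank_add_finrank _ _).trans ?_
    rw [hUr]
    gcongr
    exact finrank_span_le_card _ |>.trans (by simp)
  obtain ⟨v, hv, hvU⟩ : ∃ v ∈ f.ker, v ∉ U ⊔ K ∙ e := by
    by_contra! h
    have := Submodule.finrank_mono (show f.ker ≤ U ⊔ K ∙ e from h)
    rw [hQ.finrank_eq] at hker
    omega
  obtain ⟨t, ht⟩ := exists_add_smul_singular (v := v) he hQe
  have hvperp (u : V) (hu : u ∈ U) : polar Q u (v + t • e) = 0 := by
    have : polar Q v u = 0 := LinearMap.congr_fun hv ⟨u, hu⟩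
    rw [polar_add_right, polar_smul_right, polar_comm Q u v, polar_comm Q u e, he, this]
    simp
  have hnot : v + t • e ∉ U := fun h => hvU <| by
    have := Submodule.sub_mem _ (Submodule.mem_sup_left (T := K ∙ e) h)
      (Submodule.mem_sup_right (S := U) (Submodule.smul_mem _ t (Submodule.mem_span_singleton_self e)))
    simpa using this
  have hTS : TotallySingular Q (U ⊔ K ∙ (v + t • e)) := by
    intro w hw
    obtain ⟨u, hu, z, hz, rfl⟩ := Submodule.mem_sup.1 hw
    obtain ⟨c, rfl⟩ := Submodule.mem_span_singleton.1 hz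
    rw [QuadraticMap.map_add Q, hU u hu, QuadraticMap.map_smul, ht, polar_smul_right, hvperp u hu]
    simp
  have hlt : U < U ⊔ K ∙ (v + t • e) := by
    refine lt_of_le_of_ne le_sup_left fun h => hnot ?_
    rw [h]
    exact Submodule.mem_sup_right (Submodule.mem_span_singleton_self _)
  have := Submodule.finrank_lt_finrank_of_lt hlt
  have := hle _ hTS
  omega

open scoped Classical in
/-- The indicator function of a set of projective points, as a function on vectors. -/
noncomputable def indicatorWeight (O : Set (ℙ K V)) (v : V) : ℤ :=
  if h : v = 0 then 0 else if Projectivization.mk K v h ∈ O then 1 else 0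

theorem isHomogeneous_indicatorWeight (O : Set (ℙ K V)) : IsHomogeneous K (indicatorWeight O) := by
  refine ⟨by simp [indicatorWeight], fun c v hc => ?_⟩
  by_cases hv : v = 0
  · simp [hv]
  have hcv : c • v ≠ 0 := smul_ne_zero hc hv
  have : Projectivization.mk K (c • v) hcv = Projectivization.mk K v hv :=
    (Projectivization.mk_eq_mk_iff' K _ _ _ _).2 ⟨c, rfl⟩
  rw [indicatorWeight, indicatorWeight, dif_neg hcv, dif_neg hv, this]

open scoped Classical in
theorem sum_indicatorWeight [Fintype K] [Finite V] (O : Set (ℙ K V)) (W : Submodule K V)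
    [Fintype W] : ∑ w : W, indicatorWeight O (w : V) =
      (Fintype.card K - 1) * ({P : ℙ K V | P ∈ O ∧ P.submodule ≤ W}.ncard : ℤ) := by
  have := Fintype.ofFinite V
  have := Fintype.ofFinite (ℙ K V)
  have hO := isHomogeneous_indicatorWeight O
  have hW : IsHomogeneous K (fun v => if v ∈ W then indicatorWeight O v else 0) := by
    refine ⟨by simp [hO.map_zero], fun c v hc => ?_⟩
    simp only [hO.map_smul c v hc, W.smul_mem_iff hc]
  have h1 : ∑ w : W, indicatorWeight O (w : V) = ∑ v, if v ∈ W then indicatorWeight O v else 0 := by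
    rw [← Finset.sum_filter, Finset.sum_subtype (p := (· ∈ W)) _ (by simp)]
  have h2 (P : ℙ K V) : (if P.rep ∈ W then indicatorWeight O P.rep else 0) =
      if P ∈ O ∧ P.submodule ≤ W then 1 else 0 := by
    have : P.submodule ≤ W ↔ P.rep ∈ W := by
      rw [Projectivization.submodule_eq, Submodule.span_singleton_le_iff_mem]
    rw [this]
    by_cases hP : P.rep ∈ W <;> simp [hP, indicatorWeight, P.rep_nonzero]
  rw [h1, hW.sum_eq, Set.ncard_eq_toFinset_card']
  simp only [h2, Finset.sum_boole, Set.toFinset_ofPred]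

theorem IsOvoid.isWeightedOvoid [Fintype K] [Finite V] {r m : ℕ} {O : Set (ℙ K V)}
    (hQ : IsEllipticForm Q r) (hO : IsOvoid Q m O) :
    IsWeightedOvoid Q r m (indicatorWeight O) := by
  classical
  have := hQ.finiteDimensional
  refine ⟨isHomogeneous_indicatorWeight O, fun v hv => ?_, fun W _ hW hr => ?_⟩
  · have hv0 : v ≠ 0 := by rintro rfl; simp at hv
    have : Projectivization.mk K v hv0 ∉ O := fun h => hv <| hO.subset_points h v <| by
      rw [Projectivization.submodule_mk]
      exact Submodule.mem_span_singleton_self v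
    simp [indicatorWeight, hv0, this]
  · have hgen : IsGenerator Q W := by
      refine ⟨hW, fun U hU hWU => ?_⟩
      exact (Submodule.eq_of_le_of_finrank_le hWU (hr ▸ hQ.finrank_le U hU)).ge
    rw [sum_indicatorWeight, Set.ncard_def, hO.encard_inter W hgen]
    simp

/-- Modulo `M`, `q ^ (r + 1)` is 1 or `q` according to the parity of `r`. A factor 2 must then be
cancelled: for `q` even it is coprime to `M = q + 1`, for `q` odd it is part of `M = 2 * (q + 1)`.
-/
theorem F_modEq_zero {q r : ℕ} {m : ℤ} (h : ∀ M : ℤ, M ∣ 2 * ((q : ℤ) + 1) → M ∣ (q : ℤ) ^ 2 - 1 →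
    M ∣ m * ((q : ℤ) ^ (r + 1) + 1) - 2 * m ^ 2) : F r q m ≡ 0 [ZMOD ((q : ℤ) + 1)] := by
  rw [Int.modEq_zero_iff_dvd, F]
  have key {M : ℤ} (h1 : M ∣ 2 * ((q : ℤ) + 1)) (h2 : M ∣ (q : ℤ) ^ 2 - 1) :
      (Odd r → M ∣ 2 * (m ^ 2 - m)) ∧ (¬ Odd r → M ∣ 2 * m ^ 2 - (q + 1) * m) := by
    have h0 := h M h1 h2
    constructor
    · intro hr
      have := (((pow_modEq_one_or_self h2 (r + 1)).1 hr.add_one).mul_left m).sub h0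
      rwa [show m * ((q : ℤ) ^ (r + 1) - 1) - (m * ((q : ℤ) ^ (r + 1) + 1) - 2 * m ^ 2) =
        2 * (m ^ 2 - m) by ring] at this
    · intro hr
      have := (((pow_modEq_one_or_self h2 (r + 1)).2
        (Nat.not_odd_iff_even.1 hr).add_one).mul_left m).sub h0
      rwa [show m * ((q : ℤ) ^ (r + 1) - q) - (m * ((q : ℤ) ^ (r + 1) + 1) - 2 * m ^ 2) =
        2 * m ^ 2 - (q + 1) * m by ring] at this
  by_cases hq : Even q
  · have hM := key (M := (q : ℤ) + 1) (dvd_mul_left _ _) ⟨q - 1, by ring⟩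
    have hcop : IsCoprime ((q : ℤ) + 1) 2 := by
      obtain ⟨k, rfl⟩ := hq
      exact ⟨1, -k, by push_cast; ring⟩
    by_cases hr : Odd r
    · rw [if_pos hr]
      exact hcop.dvd_of_dvd_mul_left (hM.1 hr)
    · rw [if_neg hr, if_pos hq]
      refine hcop.dvd_of_dvd_mul_left ?_
      simpa using (hM.2 hr).add (dvd_mul_right ((q : ℤ) + 1) m)
  · obtain ⟨k, hk⟩ := Nat.not_even_iff_odd.1 hq
    have hq' : (q : ℤ) = 2 * k + 1 := by exact_mod_cast hk
    have hM := key (M := 2 * ((q : ℤ) + 1)) dvd_rfl ⟨k, by rw [hq']; ring⟩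
    by_cases hr : Odd r
    · rw [if_pos hr]
      exact Int.dvd_of_mul_dvd_mul_left two_ne_zero (hM.1 hr)
    · rw [if_neg hr, if_neg hq]
      have hdiv : ((q : ℤ) + 1) / 2 = k + 1 := by omega
      rw [hdiv]
      obtain ⟨c, hc⟩ := hM.2 hr
      refine ⟨c + m, ?_⟩
      rw [hq'] at hc ⊢
      linarith

end

end EllipticQuadric

theorem theorem1 {K V : Type*} [Field K] [Finite K] [AddCommGroup V] [Module K V]
    (q r m : ℕ) (hq : Nat.card K = q) (hr : 1 ≤ r)
    (Q : QuadraticForm K V) (hQ : EllipticQuadric.IsElliptic Q r)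
    (hO : ∃ O : Set (ℙ K V), EllipticQuadric.IsOvoid Q m O) :
    EllipticQuadric.F r q (m : ℤ) ≡ 0 [ZMOD ((q : ℤ) + 1)] := by
  obtain ⟨O, hO⟩ := hO
  have := Fintype.ofFinite K
  have hE := hQ.isEllipticForm
  have := hE.finiteDimensional
  have : Finite V := Module.finite_of_finite K
  have := Fintype.ofFinite V
  have hg := hO.isWeightedOvoid hE
  rw [Nat.card_eq_fintype_card] at hq
  subst hq
  -- Indicator weights equal their squares, so `n` is the total weight.
  refine EllipticQuadric.F_modEq_zero fun M h1 h2 => hg.dvd_sum_sq h1 h2 hE ?_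
  rw [← hg.sum_eq_total hE]
  refine Finset.sum_congr rfl fun v _ => ?_
  simp only [EllipticQuadric.indicatorWeight]
  split_ifs <;> simp
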